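/- Let $G$ be a compact Lie group with normalised Haar measure, and let $\widehat G$ be the set of equivalence classes of continuous irreducible unitary representations of $G$; for each class fix a matrix representative $\xi:G\to U(d_\xi)\subset\mathbb C^{d_\xi\times d_\xi}$. Let $0<r\le 1$ and let $A:L^2(G)\to L^2(G)$ be a continuous linear operator whose matrix-valued symbol $$\sigma_A(x,\xi)=\xi(x)^*(A\xi)(x),\qquad (A\xi)(x)_{ij}=(A\xi_{ij})(x),$$ does not depend on $x$, i.e. for each $[\xi]\in\widehat G$ there is a matrix $\sigma_A(\xi)\in\mathbb C^{d_\xi\times d_\xi}$ with $\sigma_A(x,\xi)=\sigma_A(\xi)$ for almost every $x\in G$ (that is, $A$ is left-invariant). Suppose that $$\sum_{[\xi]\in\widehat G} d_\xi\,\|\sigma_A(\xi)\|_{S_r}^r<\infty,\qquad \|\sigma_A(\xi)\|_{S_r}=\left(\operatorname{Tr}|\sigma_A(\xi)|^r\right)^{1/r}.$$ Then $A$ is $r$-nuclear on $L^2(G)$: there are sequences $(x_n')$ in the dual of $L^2(G)$ and $(y_n)$ in $L^2(G)$ with $\sum_n\|x_n'\|^r\|y_n\|^r<\infty$ and $Af=\sum_n\langle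 f,x_n'\rangle\,y_n$ for all $f\in L^2(G)$. -/

import Mathlib

open MeasureTheory
open scoped Manifold ContDiff

noncomputable section

/-- A bounded linear operator `T : X → Y` between normed spaces is `r`-nuclear if
`T x = ∑ₙ ⟨x, xₙ'⟩ yₙ` for sequences `xₙ' ∈ X'`, `yₙ ∈ Y` with `∑ₙ ‖xₙ'‖ ^ r ‖yₙ‖ ^ r < ∞`. -/
def IsRNuclear {𝕜 X Y : Type*} [RCLike 𝕜] [NormedAddCommGroup X] [NormedSpace 𝕜 X]
    [NormedAddCommGroup Y] [NormedSpace 𝕜 Y] (r : ℝ) (T : X →L[𝕜] Y) : Prop :=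
  ∃ (x' : ℕ → StrongDual 𝕜 X) (y : ℕ → Y),
    (∀ x : X, HasSum (fun n => x' n x • y n) (T x)) ∧
      Summable (fun n => ‖x' n‖ ^ r * ‖y n‖ ^ r)

open scoped MatrixOrder in
/-- The Schatten (quasi)norm `‖M‖_{S_r} = (Tr |M| ^ r) ^ (1/r)` of a complex square matrix, where
`|M| = (M* M) ^ (1/2)` and powers of matrices are taken in the functional calculus. -/
def schattenNorm {d : ℕ} (r : ℝ) (M : Matrix (Fin d) (Fin d) ℂ) : ℝ :=
  (Matrix.trace (CFC.abs M ^ r)).re ^ (1 / r)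

/-- The representation on `ℂ ^ d` attached to a homomorphism into the unitary group `U(d)`. -/
def unitaryRep {G : Type*} [Group G] {d : ℕ} (π : G →* Matrix.unitaryGroup (Fin d) ℂ) :
    Representation ℂ G (Fin d → ℂ) :=
  (Matrix.toLinAlgEquiv' : Matrix (Fin d) (Fin d) ℂ ≃ₐ[ℂ] _).toAlgHom.toMonoidHom.comp
    ((Matrix.unitaryGroup (Fin d) ℂ).subtype.comp π)

/-- A continuous irreducible unitary (matrix) representation of `G`. -/
structure UnitaryIrrep (G : Type*) [Group G] [TopologicalSpace G] where
  dim : ℕ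
  hom : G →* Matrix.unitaryGroup (Fin dim) ℂ
  continuous_hom : Continuous hom
  irreducible : (unitaryRep hom).IsIrreducible

namespace UnitaryIrrep

variable {G : Type*} [Group G] [TopologicalSpace G]

/-- The matrix `ξ(x)`. -/
def mat (ξ : UnitaryIrrep G) (x : G) : Matrix (Fin ξ.dim) (Fin ξ.dim) ℂ := (ξ.hom x).1

/-- The matrix coefficient `ξ_{ij}`, a continuous function on `G`. -/
def coeff (ξ : UnitaryIrrep G) (i j : Fin ξ.dim) : C(G, ℂ) where
  toFun x := ξ.mat x i j
  continuous_toFun := (continuous_subtype_val.comp ξ.continuous_hom).matrix_elem i j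

/-- Equivalence of representations: existence of an invertible intertwining operator. -/
instance setoid (G : Type*) [Group G] [TopologicalSpace G] : Setoid (UnitaryIrrep G) where
  r ξ η := Nonempty ((unitaryRep ξ.hom).Equiv (unitaryRep η.hom))
  iseqv :=
    { refl := fun _ => ⟨Representation.Equiv.refl _⟩
      symm := fun ⟨e⟩ => ⟨e.symm⟩
      trans := fun ⟨e⟩ ⟨f⟩ => ⟨e.trans f⟩ }

end UnitaryIrrep

/-- The unitary dual `Ĝ`. -/
def UnitaryDual (G : Type*) [Group G] [TopologicalSpace G] : Type _ :=
  Quotient (UnitaryIrrep.setoid G)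

/-- The class `[ξ] ∈ Ĝ`. -/
def UnitaryIrrep.cls {G : Type*} [Group G] [TopologicalSpace G] (ξ : UnitaryIrrep G) :
    UnitaryDual G :=
  Quotient.mk (UnitaryIrrep.setoid G) ξ

/-- The matrix-valued symbol `σ_A(x, ξ) = ξ(x)* (A ξ)(x)` of a bounded operator on `L²(G)`, where
`(A ξ)(x)_{ij} = (A ξ_{ij})(x)`; it is determined for almost every `x`. -/
def matrixSymbol {G : Type*} [Group G] [TopologicalSpace G] [CompactSpace G]
    [MeasurableSpace G] [BorelSpace G] {μ : Measure G} [IsFiniteMeasure μ]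
    (A : Lp ℂ 2 μ →L[ℂ] Lp ℂ 2 μ) (x : G) (ξ : UnitaryIrrep G) :
    Matrix (Fin ξ.dim) (Fin ξ.dim) ℂ :=
  (ξ.mat x).conjTranspose *
    Matrix.of fun i j => (A (ContinuousMap.toLp 2 μ ℂ (ξ.coeff i j)) : G → ℂ) x

end

/-! If the symbol is a constant matrix `σ`, unitarity of `ξ(x)` turns `ξ* (Aξ) = σ` into `Aξ = ξσ`:
on the span of each row of coefficients `ξ_{i1}, …, ξ_{id}`, `A` acts as the matrix `σ`. Take an
orthonormal eigenbasis `v^m` of `|σ|`, so that `‖σ v^m‖` is the `m`-th singular value `s_m`. The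
vectors `√d ∑ⱼ v^m_j ξ_{ij}`, one representative per class, form a Hilbert basis `b` of `L²(G)`, and
`A` sends each to a vector of norm `s_m`. Then `Af = ∑ ⟨b, f⟩ A b` is the nuclear decomposition: the
`r`-th powers sum to `∑_ξ ∑_i ∑_m s_m^r = ∑_ξ d_ξ ‖σ(ξ)‖_{S_r}^r`, the factor `d_ξ` counting rows.

Orthonormality is Schur orthogonality (`inner_coeffLp_self`, `inner_coeffLp_of_not_equiv`);
completeness is Peter–Weyl (`coeffComplement_eq_bot`). For the latter, convolution by a Hermitian
kernel is compact, symmetric and commutes with right translations. A nonzero eigenvalue on the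
complement of the coefficients would give a finite-dimensional right-invariant space of continuous
functions; a minimal invariant subspace consists of coefficients of an irreducible representation,
hence is orthogonal to itself. So all these operators vanish on the complement, which is therefore
zero. -/

/-! ### Compactness of integral-type operators -/

section CompactOperators

variable {X H : Type*} [TopologicalSpace X] [CompactSpace X]
  [NormedAddCommGroup H] [InnerProductSpace ℂ H]

/-- The operator `g ↦ (x ↦ ⟪φ x, g⟫)` from a Hilbert space to continuous functions. -/
noncomputable def innerOperator (φ : C(X, H)) : H →L[ℂ] C(X, ℂ) :=
  LinearMap.mkContinuous
    { toFun := fun g => ⟨fun x => inner ℂ (φ x) g, by fun_prop⟩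
      map_add' := fun f g => by ext x; simp
      map_smul' := fun c g => by ext x; simp }
    ‖φ‖ (fun g => by
      rw [ContinuousMap.norm_le _ (by positivity)]
      intro x
      exact (norm_inner_le_norm _ _).trans (by gcongr; exact φ.norm_coe_le_norm x))

@[simp] lemma innerOperator_apply (φ : C(X, H)) (g : H) (x : X) :
    innerOperator φ g x = inner ℂ (φ x) g := rfl

/-- Arzelà–Ascoli: for `‖g‖ ≤ 1`, Cauchy–Schwarz bounds the values by `‖φ‖` and the increments by
`‖φ x - φ y‖`, uniformly in `g`. -/
lemma isCompactOperator_innerOperator (φ : C(X, H)) : IsCompactOperator (innerOperator φ) := by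
  refine (isCompactOperator_iff_isCompact_closure_image_closedBall
    (innerOperator φ).toLinearMap zero_lt_one).2 ?_
  let e := ContinuousMap.isometryEquivBoundedOfCompact X ℂ
  have key : IsCompact (closure (e '' (innerOperator φ '' Metric.closedBall 0 1))) := by
    refine BoundedContinuousFunction.arzela_ascoli (Metric.closedBall 0 ‖φ‖)
      (isCompact_closedBall _ _) _ ?_ ?_
    · rintro _ x ⟨_, ⟨g, hg, rfl⟩, rfl⟩
      rw [mem_closedBall_zero_iff] at hg ⊢
      change ‖inner ℂ (φ x) g‖ ≤ _
      exact (norm_inner_le_norm _ _).trans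
        ((mul_le_of_le_one_right (norm_nonneg _) hg).trans (φ.norm_coe_le_norm x))
    · intro x
      rw [Metric.equicontinuousAt_iff_right]
      intro ε hε
      filter_upwards [Metric.tendsto_nhds.1 (φ.continuous.tendsto x) ε hε]
      rintro y hy ⟨_, ⟨_, ⟨g, hg, rfl⟩, rfl⟩⟩
      rw [mem_closedBall_zero_iff] at hg
      change dist (inner ℂ (φ x) g) (inner ℂ (φ y) g) < ε
      rw [dist_eq_norm, ← inner_sub_left]
      refine (norm_inner_le_norm _ _).trans_lt
        ((mul_le_of_le_one_right (norm_nonneg _) hg).trans_lt ?_)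
      rwa [← dist_eq_norm, dist_comm]
  have := key.image e.symm.continuous
  rw [← e.coe_toHomeomorph_symm, e.toHomeomorph.symm.image_closure] at this
  simpa [Set.image_image] using this

end CompactOperators

/-! ### Unimodularity of compact groups -/

section RightInvariance

variable {G : Type*} [Group G] [TopologicalSpace G] [IsTopologicalGroup G] [CompactSpace G]
  [MeasurableSpace G] [BorelSpace G]

lemma isMulRightInvariant_of_compactSpace (μ : Measure G) [μ.IsHaarMeasure]
    [IsProbabilityMeasure μ] : μ.IsMulRightInvariant := by
  refine ⟨fun g => ?_⟩
  have : IsProbabilityMeasure (μ.map (· * g)) :=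
    Measure.isProbabilityMeasure_map (by fun_prop)
  exact Measure.isHaarMeasure_eq_of_isProbabilityMeasure _ _

end RightInvariance

/-! ### Schatten norms and singular values -/

section Schatten

open scoped MatrixOrder ComplexOrder in
-- An eigenbasis of `|M|` works: `‖M v‖² = ⟨v, M* M v⟩ = ⟨v, |M|² v⟩ = λ²` for a unit eigenvector
-- with eigenvalue `λ ≥ 0`.
lemma exists_orthonormalBasis_schattenNorm {d : ℕ} {r : ℝ} (hr : 0 < r)
    (M : Matrix (Fin d) (Fin d) ℂ) :
    ∃ v : OrthonormalBasis (Fin d) ℂ (EuclideanSpace ℂ (Fin d)),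
      ∑ m, ‖WithLp.toLp 2 (M.mulVec (v m).ofLp)‖ ^ r = schattenNorm r M ^ r := by
  have hnn : (0 : Matrix (Fin d) (Fin d) ℂ) ≤ CFC.abs M := CFC.abs_nonneg M
  have hP : (CFC.abs M).PosSemidef := Matrix.nonneg_iff_posSemidef.1 hnn
  have hH : (CFC.abs M).IsHermitian := hP.1
  have hn : ∀ m, ‖WithLp.toLp 2 (M.mulVec (hH.eigenvectorBasis m).ofLp)‖ = hH.eigenvalues m := by
    intro m
    have h1 : ‖WithLp.toLp 2 (M.mulVec (hH.eigenvectorBasis m).ofLp)‖ ^ 2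
        = hH.eigenvalues m ^ 2 := by
      have h2 : M.conjTranspose * M = CFC.abs M * CFC.abs M := (CFC.abs_mul_abs M).symm
      have h3 := hH.mulVec_eigenvectorBasis m
      set v := hH.eigenvectorBasis m with hv
      have h4 : M.conjTranspose.mulVec (M.mulVec v.ofLp) =
          ((hH.eigenvalues m : ℂ) ^ 2) • v.ofLp := by
        rw [Matrix.mulVec_mulVec, h2, ← Matrix.mulVec_mulVec, h3, Matrix.mulVec_smul, h3, sq,
          mul_smul]
        rfl
      have h5 : inner ℂ (WithLp.toLp 2 (M.mulVec v.ofLp)) (WithLp.toLp 2 (M.mulVec v.ofLp)) =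
          inner ℂ v (WithLp.toLp 2 (M.conjTranspose.mulVec (M.mulVec v.ofLp))) := by
        simp only [EuclideanSpace.inner_eq_star_dotProduct]
        rw [Matrix.star_mulVec, dotProduct_comm, ← Matrix.dotProduct_mulVec, dotProduct_comm]
      rw [h4, WithLp.toLp_smul, inner_smul_right, inner_self_eq_norm_sq_to_K,
        WithLp.toLp_ofLp, inner_self_eq_norm_sq_to_K, hv, hH.eigenvectorBasis.norm_eq_one] at h5
      simp only [RCLike.ofReal_one, one_pow, mul_one] at h5
      exact Complex.ofReal_injective (by push_cast; exact h5)
    exact (sq_eq_sq₀ (norm_nonneg _) (hP.eigenvalues_nonneg m)).1 h1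
  have htr : (Matrix.trace (CFC.abs M ^ r)).re = ∑ m, hH.eigenvalues m ^ r := by
    rw [CFC.rpow_eq_cfc_real, hH.cfc_eq, Matrix.IsHermitian.cfc, Unitary.conjStarAlgAut_apply, Matrix.trace_mul_comm,
      ← mul_assoc]
    simp
  refine ⟨hH.eigenvectorBasis, ?_⟩
  simp only [hn]
  rw [schattenNorm, htr, ← Real.rpow_mul (Finset.sum_nonneg fun m _ =>
    Real.rpow_nonneg (hP.eigenvalues_nonneg m) r), one_div_mul_cancel hr.ne', Real.rpow_one]

end Schatten

/-! ### Nuclear decompositions over arbitrary index sets -/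

section Nuclear

/-- A summable family has countable support, which injects into `ℕ`; the remaining indices are
padded with zeros. As `r ≠ 0`, the terms dropped are exactly those with `x' n = 0` or `y n = 0`. -/
lemma isRNuclear_of_hasSum {𝕜 X Y ι : Type*} [RCLike 𝕜] [NormedAddCommGroup X] [NormedSpace 𝕜 X]
    [NormedAddCommGroup Y] [NormedSpace 𝕜 Y] {r : ℝ} (hr : 0 < r) (T : X →L[𝕜] Y)
    (x' : ι → StrongDual 𝕜 X) (y : ι → Y) (hT : ∀ x, HasSum (fun n => x' n x • y n) (T x))
    (hs : Summable fun n => ‖x' n‖ ^ r * ‖y n‖ ^ r) : IsRNuclear r T := by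
  let S := Function.support fun n => ‖x' n‖ ^ r * ‖y n‖ ^ r
  have hS : Countable S := hs.countable_support
  obtain ⟨f, hf⟩ := hS.exists_injective_nat
  refine ⟨Function.extend f (fun s => x' s) 0, Function.extend f (fun s => y s) 0, ?_, ?_⟩
  · intro x
    have h0 : ∀ n, n ∉ Set.range f → Function.extend f (fun s : S => x' s) 0 n x •
        Function.extend f (fun s : S => y s) 0 n = 0 := fun n hn => by
      rw [Function.extend_apply' _ _ _ (by simpa using hn)]; simp
    rw [← hf.hasSum_iff h0]
    have h1 : ∀ n, n ∉ Set.range (Subtype.val : S → ι) → x' n x • y n = 0 := by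
      intro n hn
      have : ¬ (‖x' n‖ ^ r * ‖y n‖ ^ r ≠ 0) := fun h => hn ⟨⟨n, h⟩, rfl⟩
      rw [not_not, mul_eq_zero, Real.rpow_eq_zero (norm_nonneg _) hr.ne',
        Real.rpow_eq_zero (norm_nonneg _) hr.ne', norm_eq_zero, norm_eq_zero] at this
      rcases this with h | h <;> simp [h]
    have := (Subtype.val_injective.hasSum_iff h1).2 (hT x)
    simpa [Function.comp_def, hf.extend_apply] using this
  · have h0 : ∀ n, n ∉ Set.range f → ‖Function.extend f (fun s : S => x' s) 0 n‖ ^ r *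
        ‖Function.extend f (fun s : S => y s) 0 n‖ ^ r = 0 := fun n hn => by
      rw [Function.extend_apply' _ _ _ (by simpa using hn)]; simp [hr.ne']
    rw [← hf.summable_iff h0]
    have := hs.comp_injective (Subtype.val_injective (p := (· ∈ S)))
    simpa [Function.comp_def, hf.extend_apply] using this

end Nuclear

/-! ### Schur's lemma in matrix form -/

namespace UnitaryIrrep

section Basic

variable {G : Type*} [Group G] [TopologicalSpace G] (ξ : UnitaryIrrep G)

lemma mat_mul (x y : G) : ξ.mat (x * y) = ξ.mat x * ξ.mat y := by simp [mat]

lemma conjTranspose_mul_mat (x : G) : (ξ.mat x).conjTranspose * ξ.mat x = 1 :=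
  Matrix.mem_unitaryGroup_iff'.1 (ξ.hom x).2

lemma mat_mul_conjTranspose (x : G) : ξ.mat x * (ξ.mat x).conjTranspose = 1 :=
  Matrix.mem_unitaryGroup_iff.1 (ξ.hom x).2

lemma unitaryRep_apply (x : G) (v : Fin ξ.dim → ℂ) :
    unitaryRep ξ.hom x v = (ξ.mat x).mulVec v := rfl

@[simp] lemma coeff_apply (i j : Fin ξ.dim) (x : G) : ξ.coeff i j x = ξ.mat x i j := rfl

lemma dim_pos : 0 < ξ.dim := by
  by_contra h
  have h0 : ξ.dim = 0 := by omega
  have := ξ.irreducible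
  obtain ⟨a, b, hab⟩ := exists_pair_ne (Subrepresentation (unitaryRep ξ.hom))
  have : IsEmpty (Fin ξ.dim) := by rw [h0]; infer_instance
  have : Subsingleton (Submodule ℂ (Fin ξ.dim → ℂ)) := inferInstance
  exact hab (Subrepresentation.toSubmodule_injective (Subsingleton.elim _ _))

/-- Schur's lemma: an intertwining matrix between inequivalent representations vanishes. -/
lemma eq_zero_of_intertwines {ξ η : UnitaryIrrep G} (h : ¬ ξ ≈ η)
    (M : Matrix (Fin ξ.dim) (Fin η.dim) ℂ) (hM : ∀ x, ξ.mat x * M = M * η.mat x) : M = 0 := by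
  have := ξ.irreducible
  have := η.irreducible
  let f : Representation.IntertwiningMap (unitaryRep η.hom) (unitaryRep ξ.hom) :=
    ⟨Matrix.toLin' M, fun x => LinearMap.ext fun v => by
      simp [unitaryRep_apply, Matrix.mulVec_mulVec, hM]⟩
  rcases Representation.IsIrreducible.bijective_or_eq_zero f with hf | hf
  · exact absurd (Setoid.symm (show η ≈ ξ from ⟨f.ofBijective hf⟩)) h
  · have : Matrix.toLin' M = 0 := congrArg (fun g => g.toLinearMap) hf
    simpa using this

/-- Schur's lemma: a matrix commuting with an irreducible representation is a scalar. -/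
lemma exists_eq_smul_one_of_commutes (M : Matrix (Fin ξ.dim) (Fin ξ.dim) ℂ)
    (hM : ∀ x, ξ.mat x * M = M * ξ.mat x) : ∃ c : ℂ, M = c • (1 : Matrix _ _ ℂ) := by
  have := ξ.irreducible
  let f : Representation.IntertwiningMap (unitaryRep ξ.hom) (unitaryRep ξ.hom) :=
    ⟨Matrix.toLin' M, fun x => LinearMap.ext fun v => by
      simp [unitaryRep_apply, Matrix.mulVec_mulVec, hM]⟩
  obtain ⟨c, hc⟩ :=
    (Representation.IsIrreducible.algebraMap_intertwiningMap_bijective_of_isAlgClosed).2 f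
  have h : Matrix.toLin' M = c • LinearMap.id := congrArg (fun g => g.toLinearMap) hc.symm
  refine ⟨c, Matrix.toLin'.injective ?_⟩
  rw [h, map_smul, Matrix.toLin'_one]

end Basic

/-! ### Schur orthogonality relations -/

section Orthogonality

variable {G : Type*} [Group G] [TopologicalSpace G] [CompactSpace G]
  [MeasurableSpace G] [BorelSpace G] (μ : Measure G) [IsProbabilityMeasure μ]

/-- The class of `ξ_{ij}` in `L²(G)`. -/
noncomputable def coeffLp (ξ : UnitaryIrrep G) (i j : Fin ξ.dim) : Lp ℂ 2 μ :=
  ContinuousMap.toLp 2 μ ℂ (ξ.coeff i j)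

lemma inner_coeffLp (ξ η : UnitaryIrrep G) (k l : Fin η.dim) (i j : Fin ξ.dim) :
    inner ℂ (η.coeffLp μ k l) (ξ.coeffLp μ i j) = ∫ x, star (η.mat x k l) * ξ.mat x i j ∂μ := by
  simp [coeffLp, ContinuousMap.inner_toLp, mul_comm]

lemma integrable_star_coeff_mul (ξ η : UnitaryIrrep G) (k l : Fin η.dim) (i j : Fin ξ.dim) :
    Integrable (fun x => star (η.mat x k l) * ξ.mat x i j) μ :=
  Continuous.integrable_of_hasCompactSupport
    ((η.coeff k l).continuous.star.mul (ξ.coeff i j).continuous)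
    (HasCompactSupport.of_compactSpace _)

/-- The averaged matrix units `∫ ξ(x) E_{jl} η(x)* dx` intertwine `ξ` and `η`. -/
lemma intertwines_inner_coeffLp [IsTopologicalGroup G] [μ.IsMulLeftInvariant] (ξ η : UnitaryIrrep G) (j : Fin ξ.dim)
    (l : Fin η.dim) (y : G) :
    ξ.mat y * (Matrix.of fun i k => inner ℂ (η.coeffLp μ k l) (ξ.coeffLp μ i j)) =
      (Matrix.of fun i k => inner ℂ (η.coeffLp μ k l) (ξ.coeffLp μ i j)) * η.mat y := by
  set M : Matrix (Fin ξ.dim) (Fin η.dim) ℂ :=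
    Matrix.of fun i k => inner ℂ (η.coeffLp μ k l) (ξ.coeffLp μ i j) with hM
  -- Left invariance: substituting `y * x` for `x` in the integral conjugates `M` by `ξ(y)` and
  -- `η(y)`.
  have h : ξ.mat y * M * (η.mat y).conjTranspose = M := by
    ext i k
    have h1 : M i k = ∫ x, star (η.mat (y * x) k l) * ξ.mat (y * x) i j ∂μ := by
      rw [integral_mul_left_eq_self (fun x => star (η.mat x k l) * ξ.mat x i j), hM,
        Matrix.of_apply, inner_coeffLp]
    rw [h1]
    have h2 : ∀ x, star (η.mat (y * x) k l) * ξ.mat (y * x) i j = ∑ b, ∑ a,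
        ξ.mat y i a * star (η.mat y k b) * (star (η.mat x b l) * ξ.mat x a j) := by
      intro x
      rw [mat_mul, mat_mul, Matrix.mul_apply, Matrix.mul_apply, star_sum, Finset.sum_mul_sum]
      refine Finset.sum_congr rfl fun b _ => Finset.sum_congr rfl fun a _ => ?_
      rw [star_mul]; ring
    simp_rw [h2]
    rw [integral_finsetSum _ fun b _ => integrable_finsetSum _ fun a _ =>
      (integrable_star_coeff_mul μ ξ η b l a j).const_mul _]
    rw [Matrix.mul_apply]
    refine Finset.sum_congr rfl fun b _ => ?_
    rw [integral_finsetSum _ fun a _ => (integrable_star_coeff_mul μ ξ η b l a j).const_mul _,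
      Matrix.mul_apply, Finset.sum_mul]
    refine Finset.sum_congr rfl fun a _ => ?_
    rw [integral_const_mul, hM, Matrix.of_apply, inner_coeffLp, Matrix.conjTranspose_apply]
    ring
  conv_rhs => rw [← h]
  rw [Matrix.mul_assoc _ _ (η.mat y), conjTranspose_mul_mat, Matrix.mul_one]

lemma inner_coeffLp_of_not_equiv [IsTopologicalGroup G] [μ.IsMulLeftInvariant] {ξ η : UnitaryIrrep G} (h : ¬ ξ ≈ η)
    (k l : Fin η.dim) (i j : Fin ξ.dim) :
    inner ℂ (η.coeffLp μ k l) (ξ.coeffLp μ i j) = 0 :=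
  congrFun (congrFun (eq_zero_of_intertwines h _ (intertwines_inner_coeffLp μ ξ η j l)) i) k

/-- Schur makes the matrix indexed by `(i, k)` a scalar `c`; its trace, computed from `ξ* ξ = 1`,
gives `d c = δ_{lj}`. -/
lemma inner_coeffLp_self [IsTopologicalGroup G] [μ.IsMulLeftInvariant] (ξ : UnitaryIrrep G) (k l i j : Fin ξ.dim) :
    inner ℂ (ξ.coeffLp μ k l) (ξ.coeffLp μ i j) =
      if k = i ∧ l = j then (ξ.dim : ℂ)⁻¹ else 0 := by
  obtain ⟨c, hc⟩ := ξ.exists_eq_smul_one_of_commutes _ (intertwines_inner_coeffLp μ ξ ξ j l)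
  have hc' : ∀ i k, inner ℂ (ξ.coeffLp μ k l) (ξ.coeffLp μ i j) = if k = i then c else 0 := by
    intro i k
    have := congrFun (congrFun hc i) k
    simpa [Matrix.one_apply, eq_comm] using this
  have hsum : (ξ.dim : ℂ) * c = if l = j then 1 else 0 := by
    have h1 : ∑ i, inner ℂ (ξ.coeffLp μ i l) (ξ.coeffLp μ i j) = (ξ.dim : ℂ) * c := by
      simp [hc']
    rw [← h1]
    simp_rw [inner_coeffLp]
    rw [← integral_finsetSum _ fun i _ => integrable_star_coeff_mul μ ξ ξ i l i j]
    have h2 : ∀ x, ∑ i, star (ξ.mat x i l) * ξ.mat x i j = if l = j then 1 else 0 := by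
      intro x
      have := congrFun (congrFun (ξ.conjTranspose_mul_mat x) l) j
      rwa [Matrix.mul_apply, Matrix.one_apply] at this
    simp_rw [h2]
    simp
  have hd : (ξ.dim : ℂ) ≠ 0 := by exact_mod_cast ξ.dim_pos.ne'
  have hc2 : c = if l = j then (ξ.dim : ℂ)⁻¹ else 0 := by
    split_ifs at hsum ⊢ with h
    · exact eq_inv_of_mul_eq_one_right hsum
    · exact (mul_eq_zero.1 hsum).resolve_left hd
  rw [hc', hc2]
  split_ifs <;> simp_all

end Orthogonality

end UnitaryIrrep

/-! ### Right translations, invariant spaces and convolution -/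

section RightTranslation

variable {G : Type*} [Group G] [TopologicalSpace G] [IsTopologicalGroup G]

/-- Right translation of continuous functions, `(R_z f)(y) = f(yz)`. -/
noncomputable def rightTranslate (z : G) : C(G, ℂ) →ₗ[ℂ] C(G, ℂ) where
  toFun f := f.comp (ContinuousMap.mulRight z)
  map_add' _ _ := rfl
  map_smul' _ _ := rfl

@[simp] lemma rightTranslate_apply (z : G) (f : C(G, ℂ)) (y : G) :
    rightTranslate z f y = f (y * z) := rfl

lemma rightTranslate_one (f : C(G, ℂ)) : rightTranslate 1 f = f := by ext; simp

lemma rightTranslate_mul (x y : G) (f : C(G, ℂ)) :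
    rightTranslate (x * y) f = rightTranslate x (rightTranslate y f) := by
  ext; simp [mul_assoc]

lemma continuous_rightTranslate (f : C(G, ℂ)) : Continuous fun z => rightTranslate z f :=
  (ContinuousMap.curry (⟨fun p : G × G => f (p.2 * p.1), by fun_prop⟩ : C(G × G, ℂ))).continuous

lemma rightTranslate_coeff (ξ : UnitaryIrrep G) (i j : Fin ξ.dim) (z : G) :
    rightTranslate z (ξ.coeff i j) = ∑ l, ξ.mat z l j • ξ.coeff i l := by
  ext x
  simp [UnitaryIrrep.mat_mul, Matrix.mul_apply, ContinuousMap.sum_apply, mul_comm]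

variable [CompactSpace G] [MeasurableSpace G] [BorelSpace G] (μ : Measure G)
  [IsProbabilityMeasure μ]

lemma inner_toLp_rightTranslate [μ.IsMulRightInvariant] (z : G) (f g : C(G, ℂ)) :
    inner ℂ (ContinuousMap.toLp 2 μ ℂ (rightTranslate z f))
      (ContinuousMap.toLp 2 μ ℂ (rightTranslate z g)) =
    inner ℂ (ContinuousMap.toLp 2 μ ℂ f) (ContinuousMap.toLp 2 μ ℂ g) := by
  simp only [ContinuousMap.inner_toLp]
  exact integral_mul_right_eq_self (fun x => g x * starRingEnd ℂ (f x)) z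

lemma inner_toLp_rightTranslate_right [μ.IsMulRightInvariant] (z : G) (f g : C(G, ℂ)) :
    inner ℂ (ContinuousMap.toLp 2 μ ℂ f) (ContinuousMap.toLp 2 μ ℂ (rightTranslate z g)) =
    inner ℂ (ContinuousMap.toLp 2 μ ℂ (rightTranslate z⁻¹ f)) (ContinuousMap.toLp 2 μ ℂ g) := by
  rw [← inner_toLp_rightTranslate μ z⁻¹ f, ← rightTranslate_mul, inv_mul_cancel,
    rightTranslate_one]

/-- A nonzero finite-dimensional space of continuous functions that is minimal among the right
invariant ones is spanned by matrix coefficients of an irreducible representation. -/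
lemma exists_irrep_of_minimal [μ.IsMulRightInvariant] [μ.IsOpenPosMeasure]
    (W : Submodule ℂ C(G, ℂ)) [FiniteDimensional ℂ W] (hW0 : W ≠ ⊥)
    (hW : ∀ z, ∀ f ∈ W, rightTranslate z f ∈ W)
    (hmin : ∀ Q ≤ W, (∀ z, ∀ f ∈ Q, rightTranslate z f ∈ Q) → Q = ⊥ ∨ Q = W) :
    ∃ ξ : UnitaryIrrep G, ∀ f ∈ W,
      f ∈ Submodule.span ℂ (Set.range fun p : Fin ξ.dim × Fin ξ.dim => ξ.coeff p.1 p.2) := by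
  let J : C(G, ℂ) →L[ℂ] Lp ℂ 2 μ := ContinuousMap.toLp 2 μ ℂ
  have hJ : Function.Injective J := ContinuousMap.toLp_injective μ
  let b := stdOrthonormalBasis ℂ (W.map J.toLinearMap)
  set d := Module.finrank ℂ (W.map J.toLinearMap)
  have hex : ∀ i, ∃ f ∈ W, J f = b i := fun i => by
    obtain ⟨f, hf, h⟩ := (b i).2
    exact ⟨f, hf, h⟩
  choose f hfW hf using hex
  have hon : ∀ i j, inner ℂ (J (f i)) (J (f j)) = if i = j then 1 else 0 := fun i j => by
    rw [hf, hf, ← Submodule.coe_inner]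
    exact orthonormal_iff_ite.1 b.orthonormal i j
  have hexp : ∀ g ∈ W, g = ∑ i, inner ℂ (J (f i)) (J g) • f i := by
    intro g hg
    apply hJ
    have h := congrArg Subtype.val (b.sum_repr' ⟨J g, Submodule.mem_map_of_mem hg⟩)
    simp only [map_sum, map_smul, hf]
    refine (show _ = J g from h).symm.trans ?_
    simp [Submodule.coe_inner]
  let e : (Fin d → ℂ) →ₗ[ℂ] C(G, ℂ) := Fintype.linearCombination ℂ f
  have heW : ∀ v, e v ∈ W := fun v => by
    simp only [e, Fintype.linearCombination_apply]
    exact W.sum_mem fun i _ => W.smul_mem _ (hfW i)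
  have hecoord : ∀ v i, inner ℂ (J (f i)) (J (e v)) = v i := by
    intro v i
    simp [e, Fintype.linearCombination_apply, inner_sum, inner_smul_right, hon]
  have heinj : Function.Injective e := fun v w h => by
    ext i; rw [← hecoord v, ← hecoord w, h]
  -- The matrix of right translation by `x` on `W`, in a basis orthonormal for the `L²` inner
  -- product; right invariance of `μ` makes it unitary.
  let u : G → Matrix (Fin d) (Fin d) ℂ := fun x =>
    Matrix.of fun i j => inner ℂ (J (f i)) (J (rightTranslate x (f j)))
  have hu : ∀ x j, rightTranslate x (f j) = ∑ i, u x i j • f i := fun x j =>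
    hexp _ (hW x _ (hfW j))
  have hue : ∀ x v, rightTranslate x (e v) = e ((u x).mulVec v) := by
    intro x v
    simp only [e, Fintype.linearCombination_apply, map_sum, map_smul, hu, Matrix.mulVec,
      dotProduct, Finset.sum_smul, Finset.smul_sum, smul_smul]
    rw [Finset.sum_comm]
    simp only [mul_comm]
  have hu1 : u 1 = 1 := by
    ext i j
    simp [u, rightTranslate_one, hon, Matrix.one_apply]
  have hum : ∀ x y, u (x * y) = u x * u y := by
    intro x y
    refine Matrix.toLin'.injective (LinearMap.ext fun v => heinj ?_)
    simp only [Matrix.toLin'_apply, ← Matrix.mulVec_mulVec, ← hue, rightTranslate_mul]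
  have huu : ∀ x, u x ∈ Matrix.unitaryGroup (Fin d) ℂ := by
    intro x
    rw [Matrix.mem_unitaryGroup_iff']
    ext i j
    have h := inner_toLp_rightTranslate μ x (f i) (f j)
    change inner ℂ (J _) (J _) = inner ℂ (J _) (J _) at h
    rw [hon i j, hu x i, hu x j, map_sum, map_sum] at h
    simp_rw [map_smul] at h
    rw [(orthonormal_iff_ite.2 hon).inner_sum] at h
    rw [Matrix.one_apply, ← h, Matrix.mul_apply]
    rfl
  let π : G →* Matrix.unitaryGroup (Fin d) ℂ :=
    { toFun := fun x => ⟨u x, huu x⟩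
      map_one' := Subtype.ext hu1
      map_mul' := fun x y => Subtype.ext (hum x y) }
  have hd : 0 < d := by
    rw [Module.finrank_pos_iff, Submodule.nontrivial_iff_ne_bot]
    intro h
    exact hW0 ((Submodule.map_injective_of_injective (f := J.toLinearMap) hJ) (by simpa using h))
  have hirr : (unitaryRep π).IsIrreducible := by
    have : Nonempty (Fin d) := ⟨⟨0, hd⟩⟩
    refine { exists_pair_ne := ⟨⊥, ⊤, fun h => ?_⟩, eq_bot_or_eq_top := fun P => ?_ }
    · have h' : (⊥ : Submodule ℂ (Fin d → ℂ)) = ⊤ := congrArg Subrepresentation.toSubmodule h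
      exact bot_ne_top h'
    · have hinv : ∀ z, ∀ g ∈ P.toSubmodule.map e, rightTranslate z g ∈ P.toSubmodule.map e := by
        rintro z _ ⟨v, hv, rfl⟩
        exact ⟨_, P.apply_mem_toSubmodule z hv, (hue z v).symm⟩
      have hle : P.toSubmodule.map e ≤ W := by
        rintro _ ⟨v, -, rfl⟩
        exact heW v
      rcases hmin _ hle hinv with h | h
      · left
        exact Subrepresentation.toSubmodule_injective
          (Submodule.map_injective_of_injective heinj (h.trans (Submodule.map_bot e).symm))
      · right
        refine Subrepresentation.toSubmodule_injective (eq_top_iff.2 fun v _ => ?_)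
        obtain ⟨w, hw, hwv⟩ : e v ∈ P.toSubmodule.map e := h ▸ heW v
        rwa [← heinj hwv]
  let ξ : UnitaryIrrep G :=
    { dim := d
      hom := π
      continuous_hom := by
        refine Continuous.subtype_mk (continuous_matrix fun i j => ?_) _
        exact continuous_const.inner (J.continuous.comp (continuous_rightTranslate (f j)))
      irreducible := hirr }
  refine ⟨ξ, fun g hg => ?_⟩
  rw [hexp g hg]
  refine Submodule.sum_mem _ fun j _ => Submodule.smul_mem _ _ ?_
  -- Evaluate `R_x f_j = ∑ᵢ u_{ij}(x) f_i` at the identity.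
  have hfj : f j = ∑ i, f i 1 • ξ.coeff i j := by
    ext x
    have := congrArg (fun h : C(G, ℂ) => h 1) (hu x j)
    simp only [rightTranslate_apply, one_mul] at this
    rw [this]
    simp [ContinuousMap.sum_apply, UnitaryIrrep.mat, ξ, π, mul_comm]
  rw [hfj]
  exact Submodule.sum_mem _ fun i _ => Submodule.smul_mem _ _
    (Submodule.subset_span ⟨(i, j), rfl⟩)

lemma exists_irrep_of_finiteDimensional [μ.IsMulRightInvariant] [μ.IsOpenPosMeasure]
    (W : Submodule ℂ C(G, ℂ)) [FiniteDimensional ℂ W] (hW0 : W ≠ ⊥)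
    (hW : ∀ z, ∀ f ∈ W, rightTranslate z f ∈ W) :
    ∃ ξ : UnitaryIrrep G, ∃ f ∈ W, f ≠ 0 ∧
      f ∈ Submodule.span ℂ (Set.range fun p : Fin ξ.dim × Fin ξ.dim => ξ.coeff p.1 p.2) := by
  let S : Set (Submodule ℂ C(G, ℂ)) :=
    {Q | Q ≤ W ∧ Q ≠ ⊥ ∧ ∀ z, ∀ f ∈ Q, rightTranslate z f ∈ Q}
  obtain ⟨Q, ⟨hQW, hQ0, hQ⟩, hQmin⟩ := exists_minimalFor_of_wellFoundedLT (· ∈ S)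
    (fun Q => Module.finrank ℂ Q) ⟨W, le_rfl, hW0, hW⟩
  have : FiniteDimensional ℂ Q := Submodule.finiteDimensional_of_le hQW
  obtain ⟨ξ, hξ⟩ := exists_irrep_of_minimal μ Q hQ0 hQ fun P hPQ hP => by
    by_cases hP0 : P = ⊥
    · exact Or.inl hP0
    · exact Or.inr (Submodule.eq_of_le_of_finrank_le hPQ
        (hQmin ⟨hPQ.trans hQW, hP0, hP⟩ (Submodule.finrank_mono hPQ)))
  obtain ⟨f, hf, hf0⟩ := Submodule.exists_mem_ne_zero_of_ne_bot hQ0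
  exact ⟨ξ, f, hQW hf, hf0, hξ f hf⟩

/-- The kernels `y ↦ k(y x⁻¹)`, as a continuous family in `L²(G)`. -/
noncomputable def convolutionKernel (k : C(G, ℂ)) : C(G, Lp ℂ 2 μ) :=
  ⟨fun x => ContinuousMap.toLp 2 μ ℂ (rightTranslate x⁻¹ k),
    (ContinuousMap.toLp 2 μ ℂ).continuous.comp ((continuous_rightTranslate k).comp continuous_inv)⟩

/-- The operator `g ↦ (x ↦ ∫ conj k(y x⁻¹) g(y) dy)` on `L²(G)`. -/
noncomputable def convolutionOperator (k : C(G, ℂ)) : Lp ℂ 2 μ →L[ℂ] Lp ℂ 2 μ :=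
  (ContinuousMap.toLp 2 μ ℂ).comp (innerOperator (convolutionKernel μ k))

lemma isCompactOperator_convolutionOperator (k : C(G, ℂ)) :
    IsCompactOperator (convolutionOperator μ k) :=
  (isCompactOperator_innerOperator (convolutionKernel μ k)).clm_comp (ContinuousMap.toLp 2 μ ℂ)

lemma innerOperator_convolutionKernel_apply (k g : C(G, ℂ)) (x : G) :
    innerOperator (convolutionKernel μ k) (ContinuousMap.toLp 2 μ ℂ g) x =
      ∫ y, g y * star (k (y * x⁻¹)) ∂μ := by
  rw [innerOperator_apply]
  exact ContinuousMap.inner_toLp _ _ _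

/-- The translation moves onto the kernel, where `R_{z⁻¹} R_{x⁻¹} k = R_{(xz)⁻¹} k`. -/
lemma innerOperator_rightTranslate [μ.IsMulRightInvariant] (k g : C(G, ℂ)) (z : G) :
    innerOperator (convolutionKernel μ k) (ContinuousMap.toLp 2 μ ℂ (rightTranslate z g)) =
      rightTranslate z (innerOperator (convolutionKernel μ k) (ContinuousMap.toLp 2 μ ℂ g)) := by
  ext x
  rw [rightTranslate_apply, innerOperator_apply, innerOperator_apply]
  refine (inner_toLp_rightTranslate_right μ z _ g).trans ?_
  rw [← rightTranslate_mul, ← mul_inv_rev]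
  rfl

lemma isSymmetric_convolutionOperator [μ.WeaklyRegular]
    {k : C(G, ℂ)} (hk : ∀ x, k x⁻¹ = star (k x)) :
    (convolutionOperator μ k).toLinearMap.IsSymmetric := by
  intro f g
  have hd := ContinuousMap.toLp_denseRange ℂ μ ℂ (p := 2) (by simp) (α := G)
  refine hd.induction_on₂ (p := fun f g => inner ℂ (convolutionOperator μ k f) g =
    inner ℂ f (convolutionOperator μ k g)) ?_ ?_ f g
  · exact isClosed_eq (by fun_prop) (by fun_prop)
  · intro f g
    simp only [convolutionOperator, ContinuousLinearMap.comp_apply]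
    rw [ContinuousMap.inner_toLp, ContinuousMap.inner_toLp]
    simp_rw [innerOperator_convolutionKernel_apply, ← integral_conj,
      ← integral_const_mul, ← integral_mul_const]
    -- This form of Fubini needs no second countability, only a continuous compactly supported
    -- integrand.
    rw [integral_integral_swap_of_hasCompactSupport (by fun_prop)
      (HasCompactSupport.of_compactSpace _)]
    refine integral_congr_ae (.of_forall fun x => integral_congr_ae (.of_forall fun y => ?_))
    have h : k (x * y⁻¹) = star (k (y * x⁻¹)) := by rw [← hk]; simp
    simp only [h]
    simp
    ring

end RightTranslation

/-! ### Compact symmetric operators without nonzero eigenvalues -/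

section Spectral

lemma eq_zero_of_forall_eigenvector_eq_zero {H : Type*} [NormedAddCommGroup H]
    [InnerProductSpace ℂ H] {T : H →L[ℂ] H} (hT : IsCompactOperator T)
    (hT' : T.toLinearMap.IsSymmetric) {N : Submodule ℂ H} [CompleteSpace N]
    (hinv : ∀ f ∈ N, T f ∈ N) (h : ∀ c : ℂ, c ≠ 0 → ∀ f ∈ N, T f = c • f → f = 0) :
    ∀ f ∈ N, T f = 0 := by
  intro f hf
  have hS : IsCompactOperator (T.restrict hinv) := hT.restrict' (f := T.toLinearMap) hinv
  have hS' : (T.restrict hinv).IsSymmetric := hT'.restrict_invariant hinv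
  have h0 : T.restrict hinv = 0 := by
    rw [← ContinuousLinearMap.eq_zero_of_forall_hasEigenvalue_eq_zero hS hS']
    intro c hc
    by_contra hc0
    obtain ⟨v, hv⟩ := hc.exists_hasEigenvector
    exact hv.2 (Subtype.ext (h c hc0 v v.2 (congrArg Subtype.val hv.apply_eq_smul)))
  exact congrArg Subtype.val (DFunLike.congr_fun h0 ⟨f, hf⟩)

end Spectral

/-! ### The Peter–Weyl theorem -/

section PeterWeyl

variable {G : Type*} [Group G] [TopologicalSpace G]
  [CompactSpace G] [MeasurableSpace G] [BorelSpace G] (μ : Measure G)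
  [IsProbabilityMeasure μ]

/-- The orthogonal complement of all matrix coefficients. -/
noncomputable def coeffComplement : Submodule ℂ (Lp ℂ 2 μ) :=
  (Submodule.span ℂ (Set.range fun p : Σ ξ : UnitaryIrrep G, Fin ξ.dim × Fin ξ.dim =>
    p.1.coeffLp μ p.2.1 p.2.2))ᗮ

lemma mem_coeffComplement {f : Lp ℂ 2 μ} : f ∈ coeffComplement μ ↔
    ∀ (ξ : UnitaryIrrep G) (i j : Fin ξ.dim), inner ℂ (ξ.coeffLp μ i j) f = 0 := by
  rw [coeffComplement, Submodule.mem_orthogonal]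
  refine ⟨fun h ξ i j => h _ (Submodule.subset_span ⟨⟨ξ, i, j⟩, rfl⟩), fun h u hu => ?_⟩
  induction hu using Submodule.span_induction with
  | mem x hx => obtain ⟨p, rfl⟩ := hx; exact h _ _ _
  | zero => simp
  | add x y _ _ hx hy => simp [inner_add_left, hx, hy]
  | smul c x _ hx => simp [inner_smul_left, hx]

variable [IsTopologicalGroup G]

lemma rightTranslate_mem_coeffComplement [μ.IsMulRightInvariant] {f : C(G, ℂ)}
    (hf : ContinuousMap.toLp 2 μ ℂ f ∈ coeffComplement μ) (z : G) :
    ContinuousMap.toLp 2 μ ℂ (rightTranslate z f) ∈ coeffComplement μ := by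
  rw [mem_coeffComplement] at hf ⊢
  intro ξ i j
  rw [UnitaryIrrep.coeffLp, inner_toLp_rightTranslate_right, rightTranslate_coeff, map_sum,
    sum_inner]
  refine Finset.sum_eq_zero fun l _ => ?_
  rw [map_smul, inner_smul_left]
  exact mul_eq_zero_of_right _ (hf ξ i l)

lemma convolutionOperator_coeffLp [μ.IsMulRightInvariant] (k : C(G, ℂ)) (ξ : UnitaryIrrep G)
    (i j : Fin ξ.dim) : convolutionOperator μ k (ξ.coeffLp μ i j) =
      ∑ l, inner ℂ (ContinuousMap.toLp 2 μ ℂ k) (ξ.coeffLp μ i l) • ξ.coeffLp μ l j := by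
  have h : innerOperator (convolutionKernel μ k) (ξ.coeffLp μ i j) =
      ∑ l, inner ℂ (ContinuousMap.toLp 2 μ ℂ k) (ξ.coeffLp μ i l) • ξ.coeff l j := by
    ext x
    -- Commutation with right translations gives `(T g)(x) = (T R_x g)(1)`, and `R_x ξ_{ij}` is a
    -- combination of row `i`.
    have h1 := congrArg (fun g : C(G, ℂ) => g 1)
      (innerOperator_rightTranslate μ k (ξ.coeff i j) x)
    simp only [rightTranslate_apply, one_mul] at h1
    rw [UnitaryIrrep.coeffLp, ← h1, rightTranslate_coeff, map_sum, map_sum]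
    simp [ContinuousMap.sum_apply, convolutionKernel, rightTranslate_one, UnitaryIrrep.coeffLp,
      mul_comm]
  rw [convolutionOperator, ContinuousLinearMap.comp_apply, h, map_sum]
  simp [UnitaryIrrep.coeffLp]

variable [μ.IsMulRightInvariant]

/-- A symmetric operator preserving the span of the coefficients preserves its orthogonal
complement. -/
lemma convolutionOperator_mem_coeffComplement [μ.WeaklyRegular] {k : C(G, ℂ)} (hk : ∀ x, k x⁻¹ = star (k x)) :
    ∀ f ∈ coeffComplement μ, convolutionOperator μ k f ∈ coeffComplement μ := by
  intro f hf
  rw [mem_coeffComplement] at hf ⊢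
  intro ξ i j
  have := isSymmetric_convolutionOperator μ hk (ξ.coeffLp μ i j) f
  refine this.symm.trans ?_
  rw [ContinuousLinearMap.coe_coe, convolutionOperator_coeffLp, sum_inner]
  refine Finset.sum_eq_zero fun l _ => ?_
  rw [inner_smul_left, hf, mul_zero]

variable [μ.IsOpenPosMeasure]

lemma eq_zero_of_convolutionOperator_eq_smul {k : C(G, ℂ)} {c : ℂ} (hc : c ≠ 0)
    {f : Lp ℂ 2 μ} (hf : f ∈ coeffComplement μ) (hfc : convolutionOperator μ k f = c • f) :
    f = 0 := by
  let J : C(G, ℂ) →L[ℂ] Lp ℂ 2 μ := ContinuousMap.toLp 2 μ ℂ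
  have hJ : Function.Injective J := ContinuousMap.toLp_injective μ
  let E := Module.End.eigenspace (convolutionOperator μ k).toLinearMap c
  let W : Submodule ℂ C(G, ℂ) := (E ⊓ coeffComplement μ).comap J.toLinearMap
  have : FiniteDimensional ℂ E := ContinuousLinearMap.finite_dimensional_eigenspace
    (isCompactOperator_convolutionOperator μ k) c hc
  have : FiniteDimensional ℂ W := by
    have : FiniteDimensional ℂ (E ⊓ coeffComplement μ : Submodule ℂ (Lp ℂ 2 μ)) :=
      Submodule.finiteDimensional_of_le inf_le_left
    exact FiniteDimensional.of_injective (J.toLinearMap.restrict (fun g hg => hg) :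
      W →ₗ[ℂ] (E ⊓ coeffComplement μ : Submodule ℂ (Lp ℂ 2 μ)))
      (fun a b h => Subtype.ext (hJ (congrArg Subtype.val h)))
  have hmemE : ∀ {g}, J g ∈ E ↔ innerOperator (convolutionKernel μ k) (J g) = c • g := by
    intro g
    rw [Module.End.mem_eigenspace_iff, ← hJ.eq_iff, map_smul]
    rfl
  have hinv : ∀ z, ∀ g ∈ W, rightTranslate z g ∈ W := by
    rintro z g ⟨hg1, hg2⟩
    refine ⟨hmemE.2 ?_, rightTranslate_mem_coeffComplement μ hg2 z⟩
    rw [innerOperator_rightTranslate, hmemE.1 hg1, map_smul]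
  have hW : W = ⊥ := by
    by_contra hW0
    obtain ⟨ξ, g, hgW, hg0, hg⟩ := exists_irrep_of_finiteDimensional μ W hW0 hinv
    have hort : ∀ h ∈ Submodule.span ℂ
        (Set.range fun p : Fin ξ.dim × Fin ξ.dim => ξ.coeff p.1 p.2),
        inner ℂ (J h) (J g) = 0 := by
      intro h hh
      induction hh using Submodule.span_induction with
      | mem x hx => obtain ⟨p, rfl⟩ := hx; exact (mem_coeffComplement μ).1 hgW.2 ξ _ _
      | zero => simp
      | add x y _ _ hx hy => simp [inner_add_left, hx, hy]
      | smul c x _ hx => simp [inner_smul_left, hx]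
    exact hg0 (hJ ((inner_self_eq_zero.1 (hort g hg)).trans (map_zero J).symm))
  -- Since `c ≠ 0`, the eigenvector has a continuous representative, so it is seen by `W = ⊥`.
  have hfJ : f = J (c⁻¹ • innerOperator (convolutionKernel μ k) f) := by
    rw [map_smul, show J (innerOperator (convolutionKernel μ k) f) = c • f from hfc,
      inv_smul_smul₀ hc]
  have hfW : c⁻¹ • innerOperator (convolutionKernel μ k) f ∈ W := by
    change J _ ∈ E ⊓ coeffComplement μ
    rw [← hfJ]
    exact ⟨Module.End.mem_eigenspace_iff.2 hfc, hf⟩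
  rw [hW, Submodule.mem_bot] at hfW
  rw [hfJ, hfW, map_zero]

variable [μ.WeaklyRegular]

lemma convolutionOperator_eq_zero {k : C(G, ℂ)} (hk : ∀ x, k x⁻¹ = star (k x))
    {f : Lp ℂ 2 μ} (hf : f ∈ coeffComplement μ) : convolutionOperator μ k f = 0 := by
  have hcl : IsClosed (coeffComplement μ : Set (Lp ℂ 2 μ)) := Submodule.isClosed_orthogonal _
  have : CompleteSpace (coeffComplement μ) := hcl.completeSpace_coe
  exact eq_zero_of_forall_eigenvector_eq_zero (isCompactOperator_convolutionOperator μ k)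
    (isSymmetric_convolutionOperator μ hk) (convolutionOperator_mem_coeffComplement μ hk)
    (fun c hc g hg hgc => eq_zero_of_convolutionOperator_eq_smul μ hc hg hgc) f hf

/-- **Peter–Weyl theorem**: the matrix coefficients span a dense subspace of `L²(G)`. -/
theorem coeffComplement_eq_bot : coeffComplement μ = ⊥ := by
  rw [Submodule.eq_bot_iff]
  intro f hf
  have hherm : ∀ k : C(G, ℂ), (∀ x, k x⁻¹ = star (k x)) →
      inner ℂ (ContinuousMap.toLp 2 μ ℂ k) f = 0 := by
    intro k hk
    have h1 : innerOperator (convolutionKernel μ k) f = 0 :=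
      ContinuousMap.toLp_injective (p := 2) (𝕜 := ℂ) μ
        ((convolutionOperator_eq_zero μ hk hf).trans (map_zero _).symm)
    have h2 := congrArg (fun g : C(G, ℂ) => g 1) h1
    -- The vanishing function is continuous, so its value at `1`, which is `⟨k, f⟩`, is zero; no
    -- approximate identity is needed.
    simpa [convolutionKernel, rightTranslate_one] using h2
  have hall : ∀ k : C(G, ℂ), inner ℂ (ContinuousMap.toLp 2 μ ℂ k) f = 0 := by
    intro k
    -- Both `k + k'` and `i (k - k')` are Hermitian, and together they recover `k`.
    let k' : C(G, ℂ) := ⟨fun x => star (k x⁻¹), by fun_prop⟩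
    have h1 := hherm (k + k') (fun x => by simp [k', add_comm])
    have h2 := hherm (Complex.I • (k - k')) (fun x => by simp [k']; ring)
    rw [map_add, inner_add_left] at h1
    rw [map_smul, inner_smul_left, map_sub, inner_sub_left, mul_eq_zero] at h2
    have h3 := h2.resolve_left (by simp)
    linear_combination (h1 + h3) / 2
  have hd := ContinuousMap.toLp_denseRange ℂ μ ℂ (p := 2) (by simp) (α := G)
  refine Dense.eq_zero_of_inner_right ℂ hd ?_
  rintro _ ⟨k, rfl⟩
  exact hall k

end PeterWeyl

/-! ### The Hilbert basis adapted to the symbol -/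

section FourierBasis

variable {G : Type*} [Group G] [TopologicalSpace G] [CompactSpace G]
  [MeasurableSpace G] [BorelSpace G] (μ : Measure G) [IsProbabilityMeasure μ]

namespace UnitaryIrrep

/-- The linear combination `∑ⱼ vⱼ ξ_{ij}` of the `i`-th row of matrix coefficients. -/
noncomputable def rowLp (ξ : UnitaryIrrep G) (i : Fin ξ.dim) :
    EuclideanSpace ℂ (Fin ξ.dim) →ₗ[ℂ] Lp ℂ 2 μ :=
  (Fintype.linearCombination ℂ (ξ.coeffLp μ i)).comp
    (WithLp.linearEquiv 2 ℂ (Fin ξ.dim → ℂ)).toLinearMap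

lemma rowLp_apply (ξ : UnitaryIrrep G) (i : Fin ξ.dim) (v : EuclideanSpace ℂ (Fin ξ.dim)) :
    ξ.rowLp μ i v = ∑ j, v j • ξ.coeffLp μ i j := rfl

lemma rowLp_single (ξ : UnitaryIrrep G) (i j : Fin ξ.dim) :
    ξ.rowLp μ i (EuclideanSpace.single j 1) = ξ.coeffLp μ i j := by
  simp [rowLp_apply, PiLp.single_apply, Finset.sum_ite_eq']

/-- With `P` the matrix of an equivalence, `η = P ξ P⁻¹`; hence one representative per class
suffices for completeness. -/
lemma coeffLp_mem_span_of_equiv {ξ η : UnitaryIrrep G} (h : ξ ≈ η) (i j : Fin η.dim) :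
    η.coeffLp μ i j ∈ Submodule.span ℂ
      (Set.range fun p : Fin ξ.dim × Fin ξ.dim => ξ.coeffLp μ p.1 p.2) := by
  obtain ⟨e⟩ := h
  let P := LinearMap.toMatrix' (e.toLinearEquiv : (Fin ξ.dim → ℂ) →ₗ[ℂ] (Fin η.dim → ℂ))
  let Q := LinearMap.toMatrix' (e.toLinearEquiv.symm : (Fin η.dim → ℂ) →ₗ[ℂ] (Fin ξ.dim → ℂ))
  have hmat : ∀ x, η.mat x = P * ξ.mat x * Q := by
    intro x
    refine Matrix.toLin'.injective (LinearMap.ext fun v => ?_)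
    have h1 := LinearMap.congr_fun (e.toIntertwiningMap.isIntertwining' x) (e.symm v)
    simp only [LinearMap.comp_apply, unitaryRep_apply] at h1
    simp only [P, Q, Matrix.toLin'_mul, LinearMap.comp_apply, Matrix.toLin'_toMatrix',
      Matrix.toLin'_apply]
    refine Eq.trans ?_ h1.symm
    congr 1
    exact (e.apply_symm_apply v).symm
  have hc : η.coeff i j = ∑ b, ∑ a, (P i a * Q b j) • ξ.coeff a b := by
    ext x
    simp only [coeff_apply, hmat, Matrix.mul_apply, ContinuousMap.sum_apply, Finset.sum_mul,
      ContinuousMap.smul_apply, smul_eq_mul]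
    exact Finset.sum_congr rfl fun b _ => Finset.sum_congr rfl fun a _ => by ring
  rw [coeffLp, hc, map_sum]
  refine Submodule.sum_mem _ fun b _ => ?_
  rw [map_sum]
  refine Submodule.sum_mem _ fun a _ => ?_
  rw [map_smul]
  exact Submodule.smul_mem _ _ (Submodule.subset_span ⟨(a, b), rfl⟩)

variable [IsTopologicalGroup G] [μ.IsMulLeftInvariant]

lemma inner_rowLp (ξ : UnitaryIrrep G) (i k : Fin ξ.dim)
    (v w : EuclideanSpace ℂ (Fin ξ.dim)) :
    inner ℂ (ξ.rowLp μ i v) (ξ.rowLp μ k w) =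
      if i = k then (ξ.dim : ℂ)⁻¹ * inner ℂ v w else 0 := by
  simp only [rowLp_apply, sum_inner, inner_sum, inner_smul_left, inner_smul_right,
    inner_coeffLp_self]
  split_ifs with h
  · simp [h, PiLp.inner_apply, Finset.mul_sum, mul_comm, mul_left_comm]
  · simp [h]

lemma inner_rowLp_of_not_equiv {ξ η : UnitaryIrrep G} (h : ¬ ξ ≈ η) (i : Fin η.dim)
    (k : Fin ξ.dim) (v : EuclideanSpace ℂ (Fin η.dim)) (w : EuclideanSpace ℂ (Fin ξ.dim)) :
    inner ℂ (η.rowLp μ i v) (ξ.rowLp μ k w) = 0 := by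
  simp only [rowLp_apply, sum_inner, inner_sum, inner_smul_left, inner_smul_right,
    inner_coeffLp_of_not_equiv μ h, mul_zero, Finset.sum_const_zero]

lemma norm_sqrt_dim_smul_rowLp (ξ : UnitaryIrrep G) (i : Fin ξ.dim)
    (v : EuclideanSpace ℂ (Fin ξ.dim)) :
    ‖((Real.sqrt ξ.dim : ℝ) : ℂ) • ξ.rowLp μ i v‖ = ‖v‖ := by
  have hd : (ξ.dim : ℂ) ≠ 0 := by exact_mod_cast ξ.dim_pos.ne'
  have h1 := inner_rowLp μ ξ i i v v
  rw [if_pos rfl, inner_self_eq_norm_sq_to_K, inner_self_eq_norm_sq_to_K,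
    ← mul_right_inj' hd, mul_inv_cancel_left₀ hd] at h1
  have h2 : (ξ.dim : ℝ) * ‖ξ.rowLp μ i v‖ ^ 2 = ‖v‖ ^ 2 :=
    Complex.ofReal_injective (by push_cast; exact h1)
  rw [norm_smul, Complex.norm_real, Real.norm_of_nonneg (Real.sqrt_nonneg _),
    ← sq_eq_sq₀ (by positivity) (by positivity), mul_pow, Real.sq_sqrt (by positivity), h2]

end UnitaryIrrep

variable (rep : UnitaryDual G → UnitaryIrrep G)
  (v : ∀ q, OrthonormalBasis (Fin (rep q).dim) ℂ (EuclideanSpace ℂ (Fin (rep q).dim)))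

/-- The vectors `√d_ξ ∑ⱼ v^m_j ξ_{ij}`, where `(v^m)` is an orthonormal basis of `ℂ ^ d_ξ`. -/
noncomputable def fourierVector (p : Σ q, Fin (rep q).dim × Fin (rep q).dim) : Lp ℂ 2 μ :=
  ((Real.sqrt (rep p.1).dim : ℝ) : ℂ) • (rep p.1).rowLp μ p.2.1 (v p.1 p.2.2)

variable [IsTopologicalGroup G]

lemma orthonormal_fourierVector [μ.IsMulLeftInvariant] (hrep : ∀ q, (rep q).cls = q) :
    Orthonormal ℂ (fourierVector μ rep v) := by
  refine ⟨fun p => ?_, ?_⟩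
  · rw [fourierVector, UnitaryIrrep.norm_sqrt_dim_smul_rowLp]
    exact (v p.1).norm_eq_one _
  · rintro ⟨q, i, m⟩ ⟨q', i', m'⟩ hne
    simp only [fourierVector, inner_smul_left, inner_smul_right]
    by_cases hq : q = q'
    · subst hq
      rw [UnitaryIrrep.inner_rowLp, orthonormal_iff_ite.1 (v q).orthonormal]
      have : ¬ (i = i' ∧ m = m') := by rintro ⟨rfl, rfl⟩; exact hne rfl
      by_cases hi : i = i'
      · have hm : m ≠ m' := fun h => this ⟨hi, h⟩
        simp [hm]
      · simp [hi]
    · have : ¬ rep q' ≈ rep q := fun h => hq ((hrep q).symm.trans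
        ((Quotient.sound (Setoid.symm h)).trans (hrep q')))
      rw [UnitaryIrrep.inner_rowLp_of_not_equiv μ this]
      simp

lemma orthogonal_span_fourierVector [μ.WeaklyRegular] [μ.IsMulRightInvariant]
    [μ.IsOpenPosMeasure] (hrep : ∀ q, (rep q).cls = q) :
    (Submodule.span ℂ (Set.range (fourierVector μ rep v)))ᗮ = ⊥ := by
  set S := Submodule.span ℂ (Set.range (fourierVector μ rep v))
  have hrow : ∀ q i w, (rep q).rowLp μ i w ∈ S := by
    intro q i w
    rw [← (v q).sum_repr' w, map_sum]
    refine S.sum_mem fun m _ => ?_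
    rw [map_smul]
    refine S.smul_mem _ ?_
    have hd : ((Real.sqrt (rep q).dim : ℝ) : ℂ) ≠ 0 := by
      have := (rep q).dim_pos
      exact_mod_cast (Real.sqrt_pos.2 (by exact_mod_cast this)).ne'
    refine (S.smul_mem_iff hd).1 ?_
    exact Submodule.subset_span ⟨⟨q, i, m⟩, rfl⟩
  rw [← coeffComplement_eq_bot μ, coeffComplement]
  refine le_antisymm (Submodule.orthogonal_le (Submodule.span_le.2 ?_)) ?_
  · rintro _ ⟨⟨η, i, j⟩, rfl⟩
    have h : rep η.cls ≈ η := Quotient.exact (hrep η.cls)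
    refine Submodule.span_le.2 ?_ (UnitaryIrrep.coeffLp_mem_span_of_equiv μ h i j)
    rintro _ ⟨⟨a, b⟩, rfl⟩
    change UnitaryIrrep.coeffLp μ _ a b ∈ S
    rw [← UnitaryIrrep.rowLp_single]
    exact hrow _ _ _
  · rw [← coeffComplement, coeffComplement_eq_bot]
    exact bot_le

end FourierBasis

/-! ### Action of the operator on rows of coefficients -/

section Symbol

variable {G : Type*} [Group G] [TopologicalSpace G] [CompactSpace G]
  [MeasurableSpace G] [BorelSpace G] {μ : Measure G} [IsProbabilityMeasure μ]

lemma map_coeffLp_of_matrixSymbol_eq {A : Lp ℂ 2 μ →L[ℂ] Lp ℂ 2 μ} {ξ : UnitaryIrrep G}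
    {σ : Matrix (Fin ξ.dim) (Fin ξ.dim) ℂ} (hσ : ∀ᵐ x ∂μ, matrixSymbol A x ξ = σ)
    (i j : Fin ξ.dim) : A (ξ.coeffLp μ i j) = ∑ k, σ k j • ξ.coeffLp μ i k := by
  have h1 : ∑ k, σ k j • ξ.coeffLp μ i k =
      ContinuousMap.toLp 2 μ ℂ (∑ k, σ k j • ξ.coeff i k) := by
    simp [UnitaryIrrep.coeffLp]
  rw [h1]
  refine Lp.ext ?_
  filter_upwards [hσ, ContinuousMap.coeFn_toLp (p := 2) (𝕜 := ℂ) μ (∑ k, σ k j • ξ.coeff i k)]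
    with x hx hx'
  rw [hx']
  have h2 := congrArg (ξ.mat x * ·) hx
  simp only [matrixSymbol, ← Matrix.mul_assoc, ξ.mat_mul_conjTranspose, Matrix.one_mul] at h2
  have h3 := congrFun (congrFun h2 i) j
  refine h3.trans ?_
  simp [Matrix.mul_apply, ContinuousMap.sum_apply, mul_comm]

lemma map_rowLp_of_matrixSymbol_eq {A : Lp ℂ 2 μ →L[ℂ] Lp ℂ 2 μ} {ξ : UnitaryIrrep G}
    {σ : Matrix (Fin ξ.dim) (Fin ξ.dim) ℂ} (hσ : ∀ᵐ x ∂μ, matrixSymbol A x ξ = σ)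
    (i : Fin ξ.dim) (v : EuclideanSpace ℂ (Fin ξ.dim)) :
    A (ξ.rowLp μ i v) = ξ.rowLp μ i (WithLp.toLp 2 (σ.mulVec v.ofLp)) := by
  simp only [UnitaryIrrep.rowLp_apply, map_sum, map_smul, map_coeffLp_of_matrixSymbol_eq hσ,
    Matrix.mulVec, dotProduct, Finset.sum_smul, Finset.smul_sum, smul_smul]
  rw [Finset.sum_comm]
  simp only [mul_comm]

end Symbol

/-! ### Nuclearity -/

theorem isRNuclear_of_summable_schattenNorm {G : Type*} [Group G] [TopologicalSpace G]
    [IsTopologicalGroup G] [CompactSpace G] [MeasurableSpace G] [BorelSpace G]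
    (μ : Measure G) [μ.IsHaarMeasure] [IsProbabilityMeasure μ] [μ.WeaklyRegular]
    (rep : UnitaryDual G → UnitaryIrrep G) (hrep : ∀ q, (rep q).cls = q)
    {r : ℝ} (hr : 0 < r) (A : Lp ℂ 2 μ →L[ℂ] Lp ℂ 2 μ)
    (σ : ∀ q : UnitaryDual G, Matrix (Fin (rep q).dim) (Fin (rep q).dim) ℂ)
    (hσ : ∀ q : UnitaryDual G, ∀ᵐ x ∂μ, matrixSymbol A x (rep q) = σ q)
    (hsum : Summable fun q : UnitaryDual G => ((rep q).dim : ℝ) * schattenNorm r (σ q) ^ r) :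
    IsRNuclear r A := by
  have := isMulRightInvariant_of_compactSpace μ
  choose v hv using fun q => exists_orthonormalBasis_schattenNorm hr (σ q)
  have hon := orthonormal_fourierVector μ rep v hrep
  let b := HilbertBasis.mkOfOrthogonalEqBot hon (orthogonal_span_fourierVector μ rep v hrep)
  have hb : ∀ p, b p = fourierVector μ rep v p :=
    congrFun (HilbertBasis.coe_mkOfOrthogonalEqBot _ _)
  have hA : ∀ p, ‖A (b p)‖ = ‖WithLp.toLp 2 ((σ p.1).mulVec (v p.1 p.2.2).ofLp)‖ := by
    intro p
    rw [hb, fourierVector, map_smul, map_rowLp_of_matrixSymbol_eq (hσ p.1),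
      UnitaryIrrep.norm_sqrt_dim_smul_rowLp]
  refine isRNuclear_of_hasSum hr A (fun p => innerSL ℂ (b p)) (fun p => A (b p)) ?_ ?_
  · intro f
    have h := A.hasSum (b.hasSum_repr f)
    simpa [Function.comp_def, b.repr_apply_apply] using h
  · have h1 : ∀ p, ‖innerSL ℂ (b p)‖ ^ r * ‖A (b p)‖ ^ r =
        ‖WithLp.toLp 2 ((σ p.1).mulVec (v p.1 p.2.2).ofLp)‖ ^ r := by
      intro p
      rw [innerSL_apply_norm, hA, hb, hon.1, Real.one_rpow, one_mul]
    simp_rw [h1]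
    rw [summable_sigma_of_nonneg fun p => by positivity]
    refine ⟨fun q => Summable.of_finite, ?_⟩
    convert hsum using 2 with q
    -- The summand ignores the row index, which therefore contributes the factor `(rep q).dim`.
    rw [tsum_fintype, Fintype.sum_prod_type]
    simp [hv]

theorem mainTheorem6
    {E : Type*} [NormedAddCommGroup E] [NormedSpace ℝ E] [FiniteDimensional ℝ E]
    {G : Type*} [Group G] [TopologicalSpace G] [ChartedSpace E G] [LieGroup 𝓘(ℝ, E) ∞ G]
    [CompactSpace G] [T2Space G] [MeasurableSpace G] [BorelSpace G]
    (μ : Measure G) [μ.IsHaarMeasure] [IsProbabilityMeasure μ]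
    (rep : UnitaryDual G → UnitaryIrrep G) (hrep : ∀ q, (rep q).cls = q)
    (r : ℝ) (hr0 : 0 < r) (hr1 : r ≤ 1)
    (A : Lp ℂ 2 μ →L[ℂ] Lp ℂ 2 μ)
    (σ : ∀ q : UnitaryDual G, Matrix (Fin (rep q).dim) (Fin (rep q).dim) ℂ)
    (hσ : ∀ q : UnitaryDual G, ∀ᵐ x ∂μ, matrixSymbol A x (rep q) = σ q)
    (hsum : Summable fun q : UnitaryDual G => ((rep q).dim : ℝ) * schattenNorm r (σ q) ^ r) :
    IsRNuclear r A := by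
  have : IsTopologicalGroup G := topologicalGroup_of_lieGroup 𝓘(ℝ, E) ∞
  -- A compact Hausdorff manifold is metrizable, and a finite Borel measure on a metric space is
  -- weakly regular, as density of `C(G)` in `L²(G)` requires.
  have : SecondCountableTopology G := ChartedSpace.secondCountable_of_sigmaCompact E G
  have : TopologicalSpace.MetrizableSpace G :=
    TopologicalSpace.metrizableSpace_of_t3_secondCountable G
  let _ := TopologicalSpace.metrizableSpaceMetric G
  exact isRNuclear_of_summable_schattenNorm μ rep hrep hr0 A σ hσ hsum
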